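/- Let $\Bbbk$ be a field; all categories, functors and presheaves are $\Bbbk$-linear. A semigroup category is a small category $\mathcal S$ with a $\Bbbk$-bilinear tensor product $\boxtimes$ and a natural associativity isomorphism $\mathsf a$ satisfying the pentagon axiom (no unit object is required). An adjunction $(F,F^{\diamond},\eta^{F,l},\eta^{F,r},\varepsilon^{F,l},\varepsilon^{F,r})$ in $\mathcal S$ consists of objects $F,F^{\diamond}$, left $\mathcal S$-module transformations $\eta^{F,l}:\mathrm{Id}\to -\boxtimes(F^{\diamond}\boxtimes F)$, $\varepsilon^{F,l}:-\boxtimes(F\boxtimes F^{\diamond})\to\mathrm{Id}$ and right $\mathcal S$-module transformations $\eta^{F,r}:\mathrm{Id}\to(F^{\diamond}\boxtimes F)\boxtimes -$, $\varepsilon^{F,r}:(F\boxtimes F^{\diamond})\boxtimes-\to\mathrm{Id}$ such that, suppressing associators, * $(-\boxtimes F^{\diamond},-\boxtimes F,\eta^{F,l},\varepsilon^{F,l})$ and $(F\boxtimes-,F^{\diamond}\boxtimes-,\eta^{F,r},\varepsilon^{F,r})$ are adjunctions; * $\varepsilon^{F,r}_F\circ\eta^{F,l}_F=\mathrm{id}_F$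 and $\varepsilon^{F,l}_{F^{\diamond}}\circ\eta^{F,r}_{F^{\diamond}}=\mathrm{id}_{F^{\diamond}}$; * $H\boxtimes\eta^{F,r}_K=\eta^{F,l}_H\boxtimes K$ and $H\boxtimes\varepsilon^{F,r}_K=\varepsilon^{F,l}_H\boxtimes K$ for all $H,K\in\mathcal S$. Then $F^{\diamond}$ is called a right dual of $F$, and $F$ a left dual of $F^{\diamond}$; $\mathcal S$ is rigid if every object has a left and a right dual. Theorem. Let $\mathcal S$ be a rigid semigroup category, and choose for every $F\in\mathcal S$ a right dual $F^{\diamond}$ with an adjunction as above. Then the semigroup category $[\mathcal S^{\mathrm{op}},\mathbf{Vec}_{\Bbbk}]$ of $\Bbbk$-linear presheaves with Day convolution $$(P\circledast Q)(-)=\int^{H,K\in\mathcal S}\mathcal S(-,H\boxtimes K)\otimes_{\Bbbk}P(H)\otimes_{\Bbbk}Q(K)$$ admits a monoidal unit, and every monoidal unit $\mathbb 1$ of it satisfies $$\mathbb 1\;\simeq\;\mathrm{Coeq}\Big(\coprod_{F,G\in\mathcal S}\mathrm{Hom}(-,FF^{\diamond}GG^{\diamond})\rightrightarrows\coprod_{F\in\mathcal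 S}\mathrm{Hom}(-,FF^{\diamond})\Big).$$ Here one of the two maps sends the $(F,G)$ summand to the $G$ summand by $\mathrm{Hom}(-,\varepsilon^{F,r}_{G}\boxtimes G^{\diamond})$, and the other sends the $(F,G)$ summand to the $F$ summand by $\mathrm{Hom}(-,F\boxtimes\varepsilon^{G,l}_{F^{\diamond}})$. -/

import Mathlib

open CategoryTheory Opposite Limits
open scoped TensorProduct

universe w v u

/-- A semigroup category: a category with a functorial tensor product and a natural associativity
isomorphism satisfying the pentagon axiom, but with no unit object. -/
class SemigroupCategory (C : Type u) [Category.{v} C] where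
  /-- the tensor product of objects -/
  tensorObj : C → C → C
  /-- the tensor product of morphisms -/
  tensorHom {X₁ Y₁ X₂ Y₂ : C} (f : X₁ ⟶ Y₁) (g : X₂ ⟶ Y₂) : tensorObj X₁ X₂ ⟶ tensorObj Y₁ Y₂
  /-- the associator -/
  associator (X Y Z : C) : tensorObj (tensorObj X Y) Z ≅ tensorObj X (tensorObj Y Z)
  tensorHom_id (X Y : C) : tensorHom (𝟙 X) (𝟙 Y) = 𝟙 (tensorObj X Y)
  tensorHom_comp {X₁ Y₁ Z₁ X₂ Y₂ Z₂ : C} (f₁ : X₁ ⟶ Y₁) (g₁ : Y₁ ⟶ Z₁) (f₂ : X₂ ⟶ Y₂)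
    (g₂ : Y₂ ⟶ Z₂) : tensorHom (f₁ ≫ g₁) (f₂ ≫ g₂) = tensorHom f₁ f₂ ≫ tensorHom g₁ g₂
  associator_naturality {X₁ X₂ X₃ Y₁ Y₂ Y₃ : C} (f₁ : X₁ ⟶ Y₁) (f₂ : X₂ ⟶ Y₂) (f₃ : X₃ ⟶ Y₃) :
    tensorHom (tensorHom f₁ f₂) f₃ ≫ (associator Y₁ Y₂ Y₃).hom =
      (associator X₁ X₂ X₃).hom ≫ tensorHom f₁ (tensorHom f₂ f₃)
  pentagon (W X Y Z : C) :
    tensorHom (associator W X Y).hom (𝟙 Z) ≫ (associator W (tensorObj X Y) Z).hom ≫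
        tensorHom (𝟙 W) (associator X Y Z).hom =
      (associator (tensorObj W X) Y Z).hom ≫ (associator W X (tensorObj Y Z)).hom

namespace SemigroupCategory

infixr:70 " ⊠ " => SemigroupCategory.tensorObj
infixr:70 " ⊠ₘ " => SemigroupCategory.tensorHom

/-- The associator `(X ⊠ Y) ⊠ Z ≅ X ⊠ (Y ⊠ Z)`. -/
abbrev assoc {C : Type u} [Category.{v} C] [SemigroupCategory C] (X Y Z : C) :
    (X ⊠ Y) ⊠ Z ≅ X ⊠ (Y ⊠ Z) :=
  SemigroupCategory.associator X Y Z

/-- The tensor product of a semigroup category is `k`-bilinear on morphisms, that is, it is a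
`k`-linear functor `C ⊗ₖ C ⥤ C`. -/
class IsLinear (k : Type w) [Field k] (C : Type u) [Category.{v} C] [Preadditive C] [Linear k C]
    [SemigroupCategory C] : Prop where
  add_tensor {X₁ Y₁ X₂ Y₂ : C} (f f' : X₁ ⟶ Y₁) (g : X₂ ⟶ Y₂) :
    (f + f') ⊠ₘ g = (f ⊠ₘ g) + (f' ⊠ₘ g)
  tensor_add {X₁ Y₁ X₂ Y₂ : C} (f : X₁ ⟶ Y₁) (g g' : X₂ ⟶ Y₂) :
    f ⊠ₘ (g + g') = (f ⊠ₘ g) + (f ⊠ₘ g')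
  smul_tensor {X₁ Y₁ X₂ Y₂ : C} (r : k) (f : X₁ ⟶ Y₁) (g : X₂ ⟶ Y₂) :
    (r • f) ⊠ₘ g = r • (f ⊠ₘ g)
  tensor_smul {X₁ Y₁ X₂ Y₂ : C} (r : k) (f : X₁ ⟶ Y₁) (g : X₂ ⟶ Y₂) :
    f ⊠ₘ (r • g) = r • (f ⊠ₘ g)

/-- A unit of a semigroup category: an object together with natural left and right unitors
satisfying the triangle axiom. Adding it to the semigroup structure gives precisely a monoidal
category. -/
structure TensorUnit (C : Type u) [Category.{v} C] [SemigroupCategory C] where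
  /-- the unit object -/
  obj : C
  /-- the left unitor -/
  leftUnitor (X : C) : obj ⊠ X ≅ X
  /-- the right unitor -/
  rightUnitor (X : C) : X ⊠ obj ≅ X
  leftUnitor_naturality {X Y : C} (f : X ⟶ Y) :
    (𝟙 obj ⊠ₘ f) ≫ (leftUnitor Y).hom = (leftUnitor X).hom ≫ f
  rightUnitor_naturality {X Y : C} (f : X ⟶ Y) :
    (f ⊠ₘ 𝟙 obj) ≫ (rightUnitor Y).hom = (rightUnitor X).hom ≫ f
  triangle (X Y : C) :
    (assoc X obj Y).hom ≫ (𝟙 X ⊠ₘ (leftUnitor Y).hom) = (rightUnitor X).hom ⊠ₘ 𝟙 Y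

/-- An adjunction `(F, G, ηˡ, ηʳ, εˡ, εʳ)` in a semigroup category (`G` is the right dual of `F`).

* `ηˡ : Id → - ⊠ (G ⊠ F)` and `εˡ : - ⊠ (F ⊠ G) → Id` are transformations of left module
  functors, `ηʳ : Id → (G ⊠ F) ⊠ -` and `εʳ : (F ⊠ G) ⊠ - → Id` of right module functors;
* `(- ⊠ G, - ⊠ F, ηˡ, εˡ)` and `(F ⊠ -, G ⊠ -, ηʳ, εʳ)` are adjunctions;
* the two are compatible, by the mixed zigzag equations and the interchange equations. -/
structure NonunitalAdjunction {C : Type u} [Category.{v} C] [SemigroupCategory C] (F G : C) where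
  ηl (X : C) : X ⟶ X ⊠ (G ⊠ F)
  ηr (X : C) : X ⟶ (G ⊠ F) ⊠ X
  εl (X : C) : X ⊠ (F ⊠ G) ⟶ X
  εr (X : C) : (F ⊠ G) ⊠ X ⟶ X
  ηl_naturality {X Y : C} (f : X ⟶ Y) : f ≫ ηl Y = ηl X ≫ (f ⊠ₘ 𝟙 (G ⊠ F))
  ηr_naturality {X Y : C} (f : X ⟶ Y) : f ≫ ηr Y = ηr X ≫ (𝟙 (G ⊠ F) ⊠ₘ f)
  εl_naturality {X Y : C} (f : X ⟶ Y) : (f ⊠ₘ 𝟙 (F ⊠ G)) ≫ εl Y = εl X ≫ f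
  εr_naturality {X Y : C} (f : X ⟶ Y) : (𝟙 (F ⊠ G) ⊠ₘ f) ≫ εr Y = εr X ≫ f
  ηl_module (H X : C) : ηl (H ⊠ X) ≫ (assoc H X (G ⊠ F)).hom = 𝟙 H ⊠ₘ ηl X
  εl_module (H X : C) : (assoc H X (F ⊠ G)).hom ≫ (𝟙 H ⊠ₘ εl X) = εl (H ⊠ X)
  ηr_module (X H : C) : (ηr X ⊠ₘ 𝟙 H) ≫ (assoc (G ⊠ F) X H).hom = ηr (X ⊠ H)
  εr_module (X H : C) : (assoc (F ⊠ G) X H).hom ≫ εr (X ⊠ H) = εr X ⊠ₘ 𝟙 H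
  left_adjunction_left (X : C) :
    (ηl X ⊠ₘ 𝟙 G) ≫ ((assoc X G F).inv ⊠ₘ 𝟙 G) ≫ (assoc (X ⊠ G) F G).hom ≫ εl (X ⊠ G) =
      𝟙 (X ⊠ G)
  left_adjunction_right (X : C) :
    ηl (X ⊠ F) ≫ (assoc (X ⊠ F) G F).inv ≫ ((assoc X F G).hom ⊠ₘ 𝟙 F) ≫ (εl X ⊠ₘ 𝟙 F) =
      𝟙 (X ⊠ F)
  right_adjunction_left (X : C) :
    (𝟙 F ⊠ₘ ηr X) ≫ (𝟙 F ⊠ₘ (assoc G F X).hom) ≫ (assoc F G (F ⊠ X)).inv ≫ εr (F ⊠ X) =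
      𝟙 (F ⊠ X)
  right_adjunction_right (X : C) :
    ηr (G ⊠ X) ≫ (assoc G F (G ⊠ X)).hom ≫ (𝟙 G ⊠ₘ (assoc F G X).inv) ≫ (𝟙 G ⊠ₘ εr X) =
      𝟙 (G ⊠ X)
  zigzag_left : ηl F ≫ (assoc F G F).inv ≫ εr F = 𝟙 F
  zigzag_right : ηr G ≫ (assoc G F G).hom ≫ εl G = 𝟙 G
  interchange_η (H K : C) :
    (𝟙 H ⊠ₘ ηr K) ≫ (assoc H (G ⊠ F) K).inv = ηl H ⊠ₘ 𝟙 K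
  interchange_ε (H K : C) :
    (assoc H (F ⊠ G) K).hom ≫ (𝟙 H ⊠ₘ εr K) = εl H ⊠ₘ 𝟙 K

/-- A right dual of `F`: an object together with an adjunction. -/
structure RightDual {C : Type u} [Category.{v} C] [SemigroupCategory C] (F : C) where
  /-- the right dual object -/
  dual : C
  /-- the adjunction making it a right dual -/
  adj : NonunitalAdjunction F dual

/-- A semigroup category is rigid if every object has a right dual and a left dual. -/
def IsRigid (C : Type u) [Category.{v} C] [SemigroupCategory C] : Prop :=
  ∀ F : C, (∃ G : C, Nonempty (NonunitalAdjunction F G)) ∧ (∃ G : C, Nonempty (NonunitalAdjunction G F))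

end SemigroupCategory

open SemigroupCategory

/-! ### Linear presheaves -/

section Presheaf

variable (k : Type w) [Field k] (S : Type u) [Category.{u} S] [Preadditive S] [Linear k S]

/-- A presheaf of `k`-vector spaces on a `k`-linear category is linear if it acts linearly on
morphisms. -/
def IsLinearPresheaf : ObjectProperty (Sᵒᵖ ⥤ ModuleCat.{u} k) := fun P =>
  (∀ (X Y : S) (f g : X ⟶ Y), P.map (f + g).op = P.map f.op + P.map g.op) ∧
    (∀ (X Y : S) (r : k) (f : X ⟶ Y), P.map (r • f).op = r • P.map f.op)

/-- The category `[Sᵒᵖ, Vecₖ]` of `k`-linear presheaves. -/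
abbrev LinPresheaf : Type _ := (IsLinearPresheaf k S).FullSubcategory


/-- A colimit of linear presheaves is linear, so `[Sᵒᵖ, Vecₖ]` has all small colimits. -/
instance (J : Type v) [Category.{v} J] [HasColimitsOfShape J (ModuleCat.{u} k)] :
    (IsLinearPresheaf k S).IsClosedUnderColimitsOfShape J where
  colimitsOfShape_le := by
    rintro P ⟨c⟩
    have key : ∀ {X Y : S} {a b : P.obj (op Y) ⟶ P.obj (op X)},
        (∀ j, (c.ι.app j).app (op Y) ≫ a = (c.ι.app j).app (op Y) ≫ b) → a = b := by
      intro X Y a b h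
      exact (isColimitOfPreserves ((evaluation _ _).obj (op Y)) c.isColimit).hom_ext h
    have n : ∀ (j : J) {X Y : S} (f : X ⟶ Y), (c.ι.app j).app (op Y) ≫ P.map f.op =
        (c.diag.obj j).map f.op ≫ (c.ι.app j).app (op X) :=
      fun j X Y f => ((c.ι.app j).naturality f.op).symm
    refine ⟨fun X Y f g => key fun j => ?_, fun X Y r f => key fun j => ?_⟩
    · refine (n j _).trans (Eq.trans ?_ (Preadditive.comp_add _ _ _ _ _ _).symm)
      refine Eq.trans ?_ (congrArg₂ (· + ·) (n j f) (n j g)).symm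
      rw [(c.prop_diag_obj j).1 X Y f g]
      exact Preadditive.add_comp _ _ _ _ _ _
    · refine (n j _).trans (Eq.trans ?_ (Linear.comp_smul _ _ _ _ _ _).symm)
      refine Eq.trans ?_ (congrArg (r • ·) (n j f)).symm
      rw [(c.prop_diag_obj j).2 X Y r f]
      exact Linear.smul_comp _ _ _ _ _ _

end Presheaf

section DayConvolution

variable {k : Type w} [Field k] {S : Type u} [Category.{u} S] [Preadditive S] [Linear k S]

namespace LinPresheaf

/-- The value `P(X)` of a presheaf. -/
abbrev val (P : LinPresheaf k S) (X : S) : ModuleCat.{u} k := P.obj.obj (op X)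

/-- The restriction map `P(f) : P(Y) → P(X)`, linear also in `f : X ⟶ Y`. -/
def res (P : LinPresheaf k S) {X Y : S} : (X ⟶ Y) →ₗ[k] P.val Y →ₗ[k] P.val X where
  toFun f := (P.obj.map f.op).hom
  map_add' f g := by rw [P.property.1]; rfl
  map_smul' r f := by rw [P.property.2]; rfl

theorem res_id (P : LinPresheaf k S) {X : S} (x : P.val X) : P.res (𝟙 X) x = x := by
  simp [res]

theorem res_comp (P : LinPresheaf k S) {X Y Z : S} (f : X ⟶ Y) (g : Y ⟶ Z) (x : P.val Z) :
    P.res (f ≫ g) x = P.res f (P.res g x) := by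
  simp [res]

/-- The component of a morphism of presheaves. -/
def app {P Q : LinPresheaf k S} (α : P ⟶ Q) (X : S) : P.val X →ₗ[k] Q.val X :=
  (α.hom.app (op X)).hom

theorem app_res {P Q : LinPresheaf k S} (α : P ⟶ Q) {X Y : S} (f : X ⟶ Y) (x : P.val Y) :
    app α X (P.res f x) = Q.res f (app α Y x) := by
  have := congrArg (fun t => t.hom x) (α.hom.naturality f.op)
  simp [app, res]

@[simp] theorem app_id (P : LinPresheaf k S) (X : S) (x : P.val X) : app (𝟙 P) X x = x := rfl

@[simp] theorem app_comp {P Q R : LinPresheaf k S} (α : P ⟶ Q) (β : Q ⟶ R) (X : S)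
    (x : P.val X) : app (α ≫ β) X x = app β X (app α X x) := rfl

theorem hom_ext' {P Q : LinPresheaf k S} {α β : P ⟶ Q} (h : ∀ X x, app α X x = app β X x) :
    α = β := by
  apply ObjectProperty.hom_ext
  apply NatTrans.ext
  funext X
  apply ModuleCat.hom_ext
  apply LinearMap.ext
  exact h X.unop

/-- Constructor for linear presheaves. -/
def ofRes (obj : S → Type u) [∀ X, AddCommGroup (obj X)] [∀ X, Module k (obj X)]
    (res : ∀ {X Y : S}, (X ⟶ Y) →ₗ[k] obj Y →ₗ[k] obj X)
    (res_id : ∀ {X : S}, res (𝟙 X) = LinearMap.id)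
    (res_comp : ∀ {X Y Z : S} (f : X ⟶ Y) (g : Y ⟶ Z), res (f ≫ g) = res f ∘ₗ res g) :
    LinPresheaf k S where
  obj :=
    { obj := fun X => ModuleCat.of k (obj X.unop)
      map := fun f => ModuleCat.ofHom (res f.unop)
      map_id := fun X => by
        apply ModuleCat.hom_ext
        exact res_id
      map_comp := fun f g => by
        apply ModuleCat.hom_ext
        exact res_comp g.unop f.unop }
  property := by
    refine ⟨fun X Y f g => ?_, fun X Y r f => ?_⟩
    · apply ModuleCat.hom_ext
      exact map_add res f g
    · apply ModuleCat.hom_ext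
      exact map_smul res r f

/-- Constructor for morphisms of linear presheaves. -/
def mkHom {P Q : LinPresheaf k S} (a : ∀ X, P.val X →ₗ[k] Q.val X)
    (ha : ∀ {X Y : S} (f : X ⟶ Y) (x : P.val Y), a X (P.res f x) = Q.res f (a Y x)) : P ⟶ Q :=
  ObjectProperty.homMk
    { app := fun X => ModuleCat.ofHom (a X.unop)
      naturality := fun X Y f => by
        apply ModuleCat.hom_ext
        apply LinearMap.ext
        exact ha f.unop }

@[simp] theorem app_mkHom {P Q : LinPresheaf k S} (a : ∀ X, P.val X →ₗ[k] Q.val X)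
    (ha : ∀ {X Y : S} (f : X ⟶ Y) (x : P.val Y), a X (P.res f x) = Q.res f (a Y x)) (X : S)
    (x : P.val X) : app (mkHom a ha) X x = a X x := rfl

variable [SemigroupCategory S]

/-- `⨁_{H, K} S(X, H ⊠ K) ⊗ P(H) ⊗ Q(K)` -/
abbrev DayPre (P Q : LinPresheaf k S) (X : S) : Type u :=
  DirectSum (S × S) fun a => (X ⟶ a.1 ⊠ a.2) ⊗[k] (P.val a.1 ⊗[k] Q.val a.2)

open Classical in
/-- The inclusion of the summand indexed by `(H, K)`, as a bilinear map. -/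
noncomputable def dayGen (P Q : LinPresheaf k S) (X H K : S) :
    (X ⟶ H ⊠ K) →ₗ[k] (P.val H ⊗[k] Q.val K) →ₗ[k] DayPre P Q X :=
  (TensorProduct.mk k (X ⟶ H ⊠ K) (P.val H ⊗[k] Q.val K)).compr₂
    (DirectSum.lof k (S × S) (fun a => (X ⟶ a.1 ⊠ a.2) ⊗[k] (P.val a.1 ⊗[k] Q.val a.2)) (H, K))

/-- The coend relations `((h ⊠ g) ∘ f) ⊗ p ⊗ q = f ⊗ P(h)(p) ⊗ Q(g)(q)`. -/
noncomputable def dayRel (P Q : LinPresheaf k S) (X : S) : Submodule k (DayPre P Q X) :=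
  Submodule.span k { z | ∃ (H K H' K' : S) (f : X ⟶ H ⊠ K) (h : H ⟶ H') (g : K ⟶ K')
    (p : P.val H') (q : Q.val K'),
    z = dayGen P Q X H' K' (f ≫ (h ⊠ₘ g)) (p ⊗ₜ[k] q) -
      dayGen P Q X H K f (P.res h p ⊗ₜ[k] Q.res g q) }

/-- The coend `∫^{H, K} S(X, H ⊠ K) ⊗ P(H) ⊗ Q(K)`. -/
abbrev DayVal (P Q : LinPresheaf k S) (X : S) : Type u := DayPre P Q X ⧸ dayRel P Q X

/-- The maps `S(X, H ⊠ K) ⊗ P(H) ⊗ Q(K) → ∫^{H, K} S(X, H ⊠ K) ⊗ P(H) ⊗ Q(K)`. -/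
noncomputable def dayMk (P Q : LinPresheaf k S) (X H K : S) :
    (X ⟶ H ⊠ K) →ₗ[k] (P.val H ⊗[k] Q.val K) →ₗ[k] DayVal P Q X :=
  (dayGen P Q X H K).compr₂ (dayRel P Q X).mkQ

theorem dayMk_rel (P Q : LinPresheaf k S) {X H K H' K' : S} (f : X ⟶ H ⊠ K) (h : H ⟶ H')
    (g : K ⟶ K') (p : P.val H') (q : Q.val K') :
    dayMk P Q X H' K' (f ≫ (h ⊠ₘ g)) (p ⊗ₜ q) =
      dayMk P Q X H K f (P.res h p ⊗ₜ Q.res g q) := by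
  apply (Submodule.Quotient.eq _).2
  exact Submodule.subset_span ⟨H, K, H', K', f, h, g, p, q, rfl⟩

theorem dayVal_ext {P Q : LinPresheaf k S} {X : S} {M : Type*} [AddCommGroup M] [Module k M]
    {α β : DayVal P Q X →ₗ[k] M}
    (h : ∀ (H K : S) (f : X ⟶ H ⊠ K) (p : P.val H) (q : Q.val K),
      α (dayMk P Q X H K f (p ⊗ₜ q)) = β (dayMk P Q X H K f (p ⊗ₜ q))) : α = β := by
  classical
  apply Submodule.linearMap_qext
  apply DirectSum.linearMap_ext
  rintro ⟨H, K⟩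
  apply TensorProduct.ext
  apply LinearMap.ext
  intro f
  apply TensorProduct.ext'
  intro p q
  exact h H K f p q

open Classical in
/-- Linear maps out of the coend are given by compatible families. -/
noncomputable def dayLift {P Q : LinPresheaf k S} {X : S} {M : Type*} [AddCommGroup M] [Module k M]
    (φ : ∀ H K : S, (X ⟶ H ⊠ K) →ₗ[k] (P.val H ⊗[k] Q.val K) →ₗ[k] M)
    (hφ : ∀ (H K H' K' : S) (f : X ⟶ H ⊠ K) (h : H ⟶ H') (g : K ⟶ K') (p : P.val H')
      (q : Q.val K'), φ H' K' (f ≫ (h ⊠ₘ g)) (p ⊗ₜ q) = φ H K f (P.res h p ⊗ₜ Q.res g q)) :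
    DayVal P Q X →ₗ[k] M :=
  (dayRel P Q X).liftQ (DirectSum.toModule k _ _ fun a => TensorProduct.lift (φ a.1 a.2)) <| by
    rw [dayRel, Submodule.span_le]
    rintro _ ⟨H, K, H', K', f, h, g, p, q, rfl⟩
    simp [dayGen, DirectSum.toModule_lof, hφ]

theorem dayLift_mk {P Q : LinPresheaf k S} {X : S} {M : Type*} [AddCommGroup M] [Module k M]
    (φ : ∀ H K : S, (X ⟶ H ⊠ K) →ₗ[k] (P.val H ⊗[k] Q.val K) →ₗ[k] M) (hφ) {H K : S}
    (f : X ⟶ H ⊠ K) (t : P.val H ⊗[k] Q.val K) :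
    dayLift φ hφ (dayMk P Q X H K f t) = φ H K f t := by
  simp [dayLift, dayMk, dayGen, DirectSum.toModule_lof]

/-- Restriction along `f` of the presheaf `∫^{H, K} S(-, H ⊠ K) ⊗ P(H) ⊗ Q(K)`. -/
noncomputable def dayRes (P Q : LinPresheaf k S) {X Y : S} (f : X ⟶ Y) :
    DayVal P Q Y →ₗ[k] DayVal P Q X :=
  dayLift (fun H K => dayMk P Q X H K ∘ₗ Linear.leftComp k (H ⊠ K) f) <| by
    intro H K H' K' f' h g p q
    simp [← dayMk_rel]

theorem dayRes_mk (P Q : LinPresheaf k S) {X Y : S} (f : X ⟶ Y) {H K : S} (g : Y ⟶ H ⊠ K)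
    (t : P.val H ⊗[k] Q.val K) :
    dayRes P Q f (dayMk P Q Y H K g t) = dayMk P Q X H K (f ≫ g) t := by
  simp [dayRes, dayLift_mk]

/-- The Day convolution `(P ⊛ Q)(-) = ∫^{H, K} S(-, H ⊠ K) ⊗ P(H) ⊗ Q(K)`. -/
noncomputable def day (P Q : LinPresheaf k S) : LinPresheaf k S :=
  ofRes (fun X => DayVal P Q X)
    (fun {X Y} =>
      { toFun := fun f => dayRes P Q f
        map_add' := fun f g => dayVal_ext fun H K a p q => by simp [dayRes_mk]
        map_smul' := fun r f => dayVal_ext fun H K a p q => by simp [dayRes_mk] })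
    (dayVal_ext fun H K a p q => by simp [dayRes_mk])
    (fun f g => dayVal_ext fun H K a p q => by simp [dayRes_mk])

/-- The universal pairing `P(H) × Q(K) → (P ⊛ Q)(H ⊠ K)`, sending `(p, q)` to the class of
`id ⊗ p ⊗ q`. -/
noncomputable def pair (P Q : LinPresheaf k S) (H K : S) :
    P.val H →ₗ[k] Q.val K →ₗ[k] (day P Q).val (H ⊠ K) :=
  TensorProduct.curry (dayMk P Q (H ⊠ K) H K (𝟙 _))

theorem res_pair (P Q : LinPresheaf k S) {X H K : S} (f : X ⟶ H ⊠ K) (p : P.val H)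
    (q : Q.val K) : (day P Q).res f (pair P Q H K p q) = dayMk P Q X H K f (p ⊗ₜ q) := by
  have := dayRes_mk P Q f (𝟙 _) (p ⊗ₜ q)
  rw [Category.comp_id] at this
  exact this

theorem pair_res (P Q : LinPresheaf k S) {H K H' K' : S} (h : H ⟶ H') (g : K ⟶ K')
    (p : P.val H') (q : Q.val K') :
    pair P Q H K (P.res h p) (Q.res g q) = (day P Q).res (h ⊠ₘ g) (pair P Q H' K' p q) := by
  rw [res_pair]
  have := dayMk_rel P Q (𝟙 _) h g p q
  rw [Category.id_comp] at this
  exact this.symm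

/-- Morphisms out of a Day convolution are determined on pairings. -/
theorem day_hom_ext {P Q R : LinPresheaf k S} {α β : day P Q ⟶ R}
    (h : ∀ (H K : S) (p : P.val H) (q : Q.val K),
      app α _ (pair P Q H K p q) = app β _ (pair P Q H K p q)) : α = β := by
  apply hom_ext'
  intro X
  apply LinearMap.congr_fun
  apply dayVal_ext
  intro H K f p q
  rw [← res_pair]
  exact (app_res α f _).trans ((congrArg _ (h H K p q)).trans (app_res β f _).symm)

/-- The components of the morphism `dayDesc` below. -/
noncomputable def dayDescApp {P Q R : LinPresheaf k S}
    (φ : ∀ H K : S, P.val H →ₗ[k] Q.val K →ₗ[k] R.val (H ⊠ K))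
    (hφ : ∀ {H K H' K' : S} (h : H ⟶ H') (g : K ⟶ K') (p : P.val H') (q : Q.val K'),
      φ H K (P.res h p) (Q.res g q) = R.res (h ⊠ₘ g) (φ H' K' p q)) (X : S) :
    DayVal P Q X →ₗ[k] R.val X :=
  dayLift (fun H K => (LinearMap.lcomp k (R.val X) (TensorProduct.lift (φ H K))) ∘ₗ R.res)
    (fun H K H' K' f h g p q => by simp [hφ, res_comp])

theorem dayDescApp_mk {P Q R : LinPresheaf k S}
    (φ : ∀ H K : S, P.val H →ₗ[k] Q.val K →ₗ[k] R.val (H ⊠ K)) (hφ) {X H K : S}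
    (f : X ⟶ H ⊠ K) (p : P.val H) (q : Q.val K) :
    dayDescApp φ hφ X (dayMk P Q X H K f (p ⊗ₜ q)) = R.res f (φ H K p q) :=
  dayLift_mk _ _ _ _

theorem dayDescApp_res {P Q R : LinPresheaf k S}
    (φ : ∀ H K : S, P.val H →ₗ[k] Q.val K →ₗ[k] R.val (H ⊠ K)) (hφ) {X Y : S} (f : X ⟶ Y) :
    dayDescApp φ hφ X ∘ₗ dayRes P Q f = R.res f ∘ₗ dayDescApp φ hφ Y := by
  apply dayVal_ext
  intro H K a p q
  rw [LinearMap.comp_apply, LinearMap.comp_apply, dayRes_mk, dayDescApp_mk, dayDescApp_mk,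
    res_comp]

/-- A family of bilinear maps `P(H) × Q(K) → R(H ⊠ K)`, natural in `H` and `K`, induces a morphism
`P ⊛ Q ⟶ R`. -/
noncomputable def dayDesc {P Q R : LinPresheaf k S}
    (φ : ∀ H K : S, P.val H →ₗ[k] Q.val K →ₗ[k] R.val (H ⊠ K))
    (hφ : ∀ {H K H' K' : S} (h : H ⟶ H') (g : K ⟶ K') (p : P.val H') (q : Q.val K'),
      φ H K (P.res h p) (Q.res g q) = R.res (h ⊠ₘ g) (φ H' K' p q)) : day P Q ⟶ R :=
  mkHom (fun X => dayDescApp φ hφ X) (fun f x => LinearMap.congr_fun (dayDescApp_res φ hφ f) x)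

theorem app_dayDesc {P Q R : LinPresheaf k S}
    (φ : ∀ H K : S, P.val H →ₗ[k] Q.val K →ₗ[k] R.val (H ⊠ K)) (hφ) (H K : S)
    (p : P.val H) (q : Q.val K) :
    app (dayDesc φ hφ) _ (pair P Q H K p q) = φ H K p q :=
  (dayDescApp_mk φ hφ (𝟙 _) p q).trans (res_id _ _)

/-- Functoriality of Day convolution. -/
noncomputable def dayMap {P Q P' Q' : LinPresheaf k S} (α : P ⟶ P') (β : Q ⟶ Q') :
    day P Q ⟶ day P' Q' :=
  dayDesc (fun H K => (pair P' Q' H K).compl₁₂ (app α H) (app β K)) <| by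
    intro H K H' K' h g p q
    simp [app_res, pair_res]

theorem app_dayMap {P Q P' Q' : LinPresheaf k S} (α : P ⟶ P') (β : Q ⟶ Q') (H K : S)
    (p : P.val H) (q : Q.val K) :
    app (dayMap α β) _ (pair P Q H K p q) = pair P' Q' H K (app α H p) (app β K q) :=
  app_dayDesc _ _ _ _ _ _


theorem day_ext {P Q : LinPresheaf k S} {X : S} {M : Type*} [AddCommGroup M] [Module k M]
    {α β : (day P Q).val X →ₗ[k] M}
    (h : ∀ (H K : S) (f : X ⟶ H ⊠ K) (p : P.val H) (q : Q.val K),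
      α ((day P Q).res f (pair P Q H K p q)) = β ((day P Q).res f (pair P Q H K p q))) :
    α = β := by
  apply dayVal_ext
  intro H K f p q
  have := h H K f p q
  rw [res_pair] at this
  exact this

theorem day_hom_ext_left {P Q R T : LinPresheaf k S} {α β : day (day P Q) R ⟶ T}
    (h : ∀ (H K M : S) (p : P.val H) (q : Q.val K) (r : R.val M),
      app α _ (pair (day P Q) R _ M (pair P Q H K p q) r) =
        app β _ (pair (day P Q) R _ M (pair P Q H K p q) r)) : α = β := by
  apply day_hom_ext
  intro L M x r
  refine LinearMap.congr_fun (f := app α _ ∘ₗ (pair (day P Q) R L M).flip r)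
    (g := app β _ ∘ₗ (pair (day P Q) R L M).flip r) ?_ x
  apply day_ext
  intro H K f p q
  have e := pair_res (day P Q) R f (𝟙 M) (pair P Q H K p q) r
  rw [res_id] at e
  simp only [LinearMap.comp_apply, LinearMap.flip_apply]
  rw [e, app_res, app_res, h]

theorem day_hom_ext_right {P Q R T : LinPresheaf k S} {α β : day P (day Q R) ⟶ T}
    (h : ∀ (H K M : S) (p : P.val H) (q : Q.val K) (r : R.val M),
      app α _ (pair P (day Q R) H _ p (pair Q R K M q r)) =
        app β _ (pair P (day Q R) H _ p (pair Q R K M q r))) : α = β := by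
  apply day_hom_ext
  intro H L p x
  refine LinearMap.congr_fun (f := app α _ ∘ₗ pair P (day Q R) H L p)
    (g := app β _ ∘ₗ pair P (day Q R) H L p) ?_ x
  apply day_ext
  intro K M f q r
  have e := pair_res P (day Q R) (𝟙 H) f p (pair Q R K M q r)
  rw [res_id] at e
  simp only [LinearMap.comp_apply]
  rw [e, app_res, app_res, h]

theorem day_hom_ext_left₄ {P Q R T U : LinPresheaf k S} {α β : day (day (day P Q) R) T ⟶ U}
    (h : ∀ (H K M N : S) (p : P.val H) (q : Q.val K) (r : R.val M) (t : T.val N),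
      app α _ (pair (day (day P Q) R) T _ N (pair (day P Q) R _ M (pair P Q H K p q) r) t) =
        app β _ (pair (day (day P Q) R) T _ N (pair (day P Q) R _ M (pair P Q H K p q) r) t)) :
    α = β := by
  apply day_hom_ext_left
  intro L M N x r t
  refine LinearMap.congr_fun
    (f := app α _ ∘ₗ (pair (day (day P Q) R) T _ N).flip t ∘ₗ (pair (day P Q) R L M).flip r)
    (g := app β _ ∘ₗ (pair (day (day P Q) R) T _ N).flip t ∘ₗ (pair (day P Q) R L M).flip r) ?_ x
  apply day_ext
  intro H K f p q
  have e := pair_res (day P Q) R f (𝟙 M) (pair P Q H K p q) r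
  have e' := pair_res (day (day P Q) R) T (f ⊠ₘ 𝟙 M) (𝟙 N)
    (pair (day P Q) R _ M (pair P Q H K p q) r) t
  rw [res_id] at e e'
  simp only [LinearMap.comp_apply, LinearMap.flip_apply]
  rw [e, e', app_res, app_res, h]

/-- The presheaf `R(- ⊠ M)`. -/
noncomputable def shiftRight [IsLinear k S] (R : LinPresheaf k S) (M : S) : LinPresheaf k S :=
  ofRes (fun X => R.val (X ⊠ M))
    (fun {X Y} =>
      { toFun := fun f => R.res (f ⊠ₘ 𝟙 M)
        map_add' := fun f g => by rw [IsLinear.add_tensor k, map_add]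
        map_smul' := fun r f => by rw [IsLinear.smul_tensor, map_smul]; rfl })
    (LinearMap.ext fun x => by
      change R.res (𝟙 _ ⊠ₘ 𝟙 M) x = x
      rw [tensorHom_id, res_id])
    (fun f g => LinearMap.ext fun x => by
      change R.res ((f ≫ g) ⊠ₘ 𝟙 M) x = R.res (f ⊠ₘ 𝟙 M) (R.res (g ⊠ₘ 𝟙 M) x)
      rw [← res_comp, ← tensorHom_comp, Category.comp_id])

/-- The presheaf `R(M ⊠ -)`. -/
noncomputable def shiftLeft [IsLinear k S] (R : LinPresheaf k S) (M : S) : LinPresheaf k S :=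
  ofRes (fun X => R.val (M ⊠ X))
    (fun {X Y} =>
      { toFun := fun f => R.res (𝟙 M ⊠ₘ f)
        map_add' := fun f g => by rw [IsLinear.tensor_add k, map_add]
        map_smul' := fun r f => by rw [IsLinear.tensor_smul, map_smul]; rfl })
    (LinearMap.ext fun x => by
      change R.res (𝟙 M ⊠ₘ 𝟙 _) x = x
      rw [tensorHom_id, res_id])
    (fun f g => LinearMap.ext fun x => by
      change R.res (𝟙 M ⊠ₘ (f ≫ g)) x = R.res (𝟙 M ⊠ₘ f) (R.res (𝟙 M ⊠ₘ g) x)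
      rw [← res_comp, ← tensorHom_comp, Category.comp_id])

variable [IsLinear k S]

/-- For `r ∈ R(M)`, the morphism `P ⊛ Q ⟶ (P ⊛ (Q ⊛ R))(- ⊠ M)`. -/
noncomputable def assocHomAux (P Q R : LinPresheaf k S) (M : S) (r : R.val M) :
    day P Q ⟶ shiftRight (day P (day Q R)) M :=
  dayDesc (R := shiftRight (day P (day Q R)) M)
    (fun H K => ((pair P (day Q R) H (K ⊠ M)).compl₂ ((pair Q R K M).flip r)).compr₂
      ((day P (day Q R)).res (assoc H K M).hom)) <| by
    intro H K H' K' h g p q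
    change (day P (day Q R)).res (assoc H K M).hom (pair P (day Q R) H (K ⊠ M) (P.res h p)
      (pair Q R K M (Q.res g q) r)) = (day P (day Q R)).res ((h ⊠ₘ g) ⊠ₘ 𝟙 M)
        ((day P (day Q R)).res (assoc H' K' M).hom (pair P (day Q R) H' (K' ⊠ M) p
          (pair Q R K' M q r)))
    rw [← res_comp, associator_naturality, res_comp, ← pair_res, ← pair_res, res_id]

theorem app_assocHomAux (P Q R : LinPresheaf k S) (H K M : S) (p : P.val H) (q : Q.val K)
    (r : R.val M) :
    app (assocHomAux P Q R M r) (H ⊠ K) (pair P Q H K p q) =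
      (day P (day Q R)).res (assoc H K M).hom
        (pair P (day Q R) H (K ⊠ M) p (pair Q R K M q r)) :=
  app_dayDesc (R := shiftRight (day P (day Q R)) M) _ _ _ _ _ _

/-- For `r ∈ R(M)`, the map `(P ⊛ Q)(L) → (P ⊛ (Q ⊛ R))(L ⊠ M)`. -/
noncomputable def assocHomMap (P Q R : LinPresheaf k S) (L M : S) (r : R.val M) :
    (day P Q).val L →ₗ[k] (day P (day Q R)).val (L ⊠ M) :=
  app (assocHomAux P Q R M r) L

theorem assocHomMap_pair (P Q R : LinPresheaf k S) {L H K M : S} (f : L ⟶ H ⊠ K)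
    (p : P.val H) (q : Q.val K) (r : R.val M) :
    assocHomMap P Q R L M r ((day P Q).res f (pair P Q H K p q)) =
      (day P (day Q R)).res ((f ⊠ₘ 𝟙 M) ≫ (assoc H K M).hom)
        (pair P (day Q R) H (K ⊠ M) p (pair Q R K M q r)) := by
  rw [res_comp]
  exact (app_res (assocHomAux P Q R M r) f _).trans
    (congrArg ((shiftRight (day P (day Q R)) M).res f) (app_assocHomAux P Q R H K M p q r))

/-- The associativity morphism of the Day convolution: it sends the pairing of `(p, q)` and `r` to
the restriction along the associator of the pairing of `p` and `(q, r)`. -/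
noncomputable def assocHom (P Q R : LinPresheaf k S) : day (day P Q) R ⟶ day P (day Q R) :=
  dayDesc (P := day P Q) (Q := R) (R := day P (day Q R))
    (fun L M => LinearMap.flip
      { toFun := fun r => assocHomMap P Q R L M r
        map_add' := fun r r' => day_ext fun H K f p q => by
          simp only [LinearMap.add_apply, assocHomMap_pair, map_add]
        map_smul' := fun c r => day_ext fun H K f p q => by
          simp only [LinearMap.smul_apply, assocHomMap_pair, map_smul, RingHom.id_apply] }) <| by
    intro L M L' M' h g x r
    change assocHomMap P Q R L M (R.res g r) ((day P Q).res h x) =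
      (day P (day Q R)).res (h ⊠ₘ g) (assocHomMap P Q R L' M' r x)
    refine LinearMap.congr_fun (f := assocHomMap P Q R L M (R.res g r) ∘ₗ (day P Q).res h)
      (g := (day P (day Q R)).res (h ⊠ₘ g) ∘ₗ assocHomMap P Q R L' M' r) ?_ x
    apply day_ext
    intro H K f p q
    rw [LinearMap.comp_apply, LinearMap.comp_apply, ← res_comp, assocHomMap_pair,
      assocHomMap_pair, ← res_comp]
    have h1 := pair_res Q R (𝟙 K) g q r
    have h2 := pair_res P (day Q R) (𝟙 H) (𝟙 K ⊠ₘ g) p (pair Q R K M' q r)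
    rw [res_id] at h1 h2
    rw [h1, h2, ← res_comp, Category.assoc, ← associator_naturality, ← Category.assoc,
      ← Category.assoc, ← tensorHom_comp, ← tensorHom_comp, tensorHom_id, Category.comp_id,
      Category.id_comp, Category.comp_id]

theorem app_assocHom (P Q R : LinPresheaf k S) (H K M : S) (p : P.val H) (q : Q.val K)
    (r : R.val M) :
    app (assocHom P Q R) _ (pair (day P Q) R (H ⊠ K) M (pair P Q H K p q) r) =
      (day P (day Q R)).res (assoc H K M).hom
        (pair P (day Q R) H (K ⊠ M) p (pair Q R K M q r)) :=
  (app_dayDesc (P := day P Q) (Q := R) (R := day P (day Q R)) _ _ _ _ _ _).trans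
    (app_assocHomAux _ _ _ _ _ _ _ _ _)

/-- For `p ∈ P(H)`, the morphism `Q ⊛ R ⟶ ((P ⊛ Q) ⊛ R)(H ⊠ -)`. -/
noncomputable def assocInvAux (P Q R : LinPresheaf k S) (H : S) (p : P.val H) :
    day Q R ⟶ shiftLeft (day (day P Q) R) H :=
  dayDesc (R := shiftLeft (day (day P Q) R) H)
    (fun K M => ((pair (day P Q) R (H ⊠ K) M) ∘ₗ (pair P Q H K p)).compr₂
      ((day (day P Q) R).res (assoc H K M).inv)) <| by
    intro K M K' M' h g q r
    change (day (day P Q) R).res (assoc H K M).inv (pair (day P Q) R (H ⊠ K) M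
      (pair P Q H K p (Q.res h q)) (R.res g r)) = (day (day P Q) R).res (𝟙 H ⊠ₘ (h ⊠ₘ g))
        ((day (day P Q) R).res (assoc H K' M').inv (pair (day P Q) R (H ⊠ K') M'
          (pair P Q H K' p q) r))
    have e : (assoc H K M).inv ≫ ((𝟙 H ⊠ₘ h) ⊠ₘ g) =
        (𝟙 H ⊠ₘ (h ⊠ₘ g)) ≫ (assoc H K' M').inv := by
      rw [Iso.inv_comp_eq, ← Category.assoc, Iso.eq_comp_inv, associator_naturality]
    rw [← res_comp, ← e, res_comp, ← pair_res, ← pair_res, res_id]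

theorem app_assocInvAux (P Q R : LinPresheaf k S) (H K M : S) (p : P.val H) (q : Q.val K)
    (r : R.val M) :
    app (assocInvAux P Q R H p) (K ⊠ M) (pair Q R K M q r) =
      (day (day P Q) R).res (assoc H K M).inv
        (pair (day P Q) R (H ⊠ K) M (pair P Q H K p q) r) :=
  app_dayDesc (R := shiftLeft (day (day P Q) R) H) _ _ _ _ _ _

/-- For `p ∈ P(H)`, the map `(Q ⊛ R)(L) → ((P ⊛ Q) ⊛ R)(H ⊠ L)`. -/
noncomputable def assocInvMap (P Q R : LinPresheaf k S) (H L : S) (p : P.val H) :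
    (day Q R).val L →ₗ[k] (day (day P Q) R).val (H ⊠ L) :=
  app (assocInvAux P Q R H p) L

theorem assocInvMap_pair (P Q R : LinPresheaf k S) {L H K M : S} (f : L ⟶ K ⊠ M)
    (p : P.val H) (q : Q.val K) (r : R.val M) :
    assocInvMap P Q R H L p ((day Q R).res f (pair Q R K M q r)) =
      (day (day P Q) R).res ((𝟙 H ⊠ₘ f) ≫ (assoc H K M).inv)
        (pair (day P Q) R (H ⊠ K) M (pair P Q H K p q) r) := by
  rw [res_comp]
  exact (app_res (assocInvAux P Q R H p) f _).trans
    (congrArg ((shiftLeft (day (day P Q) R) H).res f) (app_assocInvAux P Q R H K M p q r))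

/-- The inverse of the associativity morphism. -/
noncomputable def assocInv (P Q R : LinPresheaf k S) : day P (day Q R) ⟶ day (day P Q) R :=
  dayDesc (P := P) (Q := day Q R) (R := day (day P Q) R)
    (fun H L =>
      { toFun := fun p => assocInvMap P Q R H L p
        map_add' := fun r r' => day_ext fun H K f p q => by
          simp only [LinearMap.add_apply, assocInvMap_pair, map_add]
        map_smul' := fun c r => day_ext fun H K f p q => by
          simp only [LinearMap.smul_apply, assocInvMap_pair, map_smul, RingHom.id_apply] }) <| by
    intro H L H' L' h g p x
    change assocInvMap P Q R H L (P.res h p) ((day Q R).res g x) =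
      (day (day P Q) R).res (h ⊠ₘ g) (assocInvMap P Q R H' L' p x)
    refine LinearMap.congr_fun (f := assocInvMap P Q R H L (P.res h p) ∘ₗ (day Q R).res g)
      (g := (day (day P Q) R).res (h ⊠ₘ g) ∘ₗ assocInvMap P Q R H' L' p) ?_ x
    apply day_ext
    intro K M f q r
    rw [LinearMap.comp_apply, LinearMap.comp_apply, ← res_comp, assocInvMap_pair,
      assocInvMap_pair, ← res_comp]
    have h1 := pair_res P Q h (𝟙 K) p q
    have h2 := pair_res (day P Q) R (h ⊠ₘ 𝟙 K) (𝟙 M) (pair P Q H' K p q) r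
    have e : (assoc H K M).inv ≫ ((h ⊠ₘ 𝟙 K) ⊠ₘ 𝟙 M) =
        (h ⊠ₘ (𝟙 K ⊠ₘ 𝟙 M)) ≫ (assoc H' K M).inv := by
      rw [Iso.inv_comp_eq, ← Category.assoc, Iso.eq_comp_inv, associator_naturality]
    rw [res_id] at h1 h2
    rw [h1, h2, ← res_comp, Category.assoc, e, ← Category.assoc,
      ← Category.assoc, ← tensorHom_comp, ← tensorHom_comp, tensorHom_id, Category.comp_id,
      Category.id_comp, Category.comp_id]

theorem app_assocInv (P Q R : LinPresheaf k S) (H K M : S) (p : P.val H) (q : Q.val K)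
    (r : R.val M) :
    app (assocInv P Q R) _ (pair P (day Q R) H (K ⊠ M) p (pair Q R K M q r)) =
      (day (day P Q) R).res (assoc H K M).inv
        (pair (day P Q) R (H ⊠ K) M (pair P Q H K p q) r) :=
  (app_dayDesc (P := P) (Q := day Q R) (R := day (day P Q) R) _ _ _ _ _ _).trans
    (app_assocInvAux _ _ _ _ _ _ _ _ _)

/-- The associator of the Day convolution. -/
noncomputable def dayAssoc (P Q R : LinPresheaf k S) : day (day P Q) R ≅ day P (day Q R) where
  hom := assocHom P Q R
  inv := assocInv P Q R
  hom_inv_id := day_hom_ext_left fun H K M p q r => by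
    rw [app_comp, app_assocHom, app_res, app_assocInv, ← res_comp, Iso.hom_inv_id, res_id, app_id]
  inv_hom_id := day_hom_ext_right fun H K M p q r => by
    rw [app_comp, app_assocInv, app_res, app_assocHom, ← res_comp, Iso.inv_hom_id, res_id, app_id]

/-- Linear presheaves on a linear semigroup category form a semigroup category under Day
convolution. -/
noncomputable instance : SemigroupCategory (LinPresheaf k S) where
  tensorObj := day
  tensorHom := dayMap
  associator := dayAssoc
  tensorHom_id P Q := day_hom_ext fun H K p q => by
    rw [app_dayMap]; rfl
  tensorHom_comp f₁ g₁ f₂ g₂ := day_hom_ext fun H K p q => by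
    rw [app_comp, app_dayMap, app_dayMap, app_dayMap]; rfl
  associator_naturality f₁ f₂ f₃ := day_hom_ext_left fun H K M p q r => by
    simp only [app_comp, dayAssoc]
    rw [app_dayMap, app_dayMap, app_assocHom, app_assocHom, app_res, app_dayMap, app_dayMap]
  pentagon P Q R T := day_hom_ext_left₄ fun H K M N p q r t => by
    simp only [app_comp, dayAssoc]
    rw [app_dayMap, app_assocHom, app_assocHom, app_res, app_assocHom, app_id]
    have e := pair_res (day P (day Q R)) T (assoc H K M).hom (𝟙 N)
      (pair P (day Q R) H (K ⊠ M) p (pair Q R K M q r)) t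
    rw [res_id] at e
    have e' := pair_res P (day Q (day R T)) (𝟙 H) (assoc K M N).hom p
      (pair Q (day R T) K _ q (pair R T M N r t))
    rw [res_id] at e'
    rw [e, app_res, app_res, app_assocHom, app_res, app_dayMap, app_assocHom, app_id, e',
      ← res_comp, ← res_comp, ← res_comp, Category.assoc, pentagon]

end LinPresheaf

end DayConvolution

section Bar

variable (k : Type w) [Field k] {S : Type u} [Category.{u} S] [Preadditive S] [Linear k S]

/-- The Yoneda embedding `F ↦ S(-, F)`. -/
def linYoneda : S ⥤ LinPresheaf k S :=
  (IsLinearPresheaf k S).lift (linearYoneda k S) fun F => by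
    refine ⟨fun X Y f g => ?_, fun X Y r f => ?_⟩
    · apply ModuleCat.hom_ext
      apply LinearMap.ext
      intro x
      exact Preadditive.add_comp _ _ _ f g x
    · apply ModuleCat.hom_ext
      apply LinearMap.ext
      intro x
      exact Linear.smul_comp _ _ _ r f x

variable [SemigroupCategory S] (D : ∀ F : S, RightDual F)

/-- `∐_{F, G} S(-, (F ⊠ F^⋄) ⊠ (G ⊠ G^⋄))` -/
noncomputable abbrev barOne : LinPresheaf k S :=
  ∐ fun a : S × S => (linYoneda k).obj ((a.1 ⊠ (D a.1).dual) ⊠ (a.2 ⊠ (D a.2).dual))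

/-- `∐_F S(-, F ⊠ F^⋄)` -/
noncomputable abbrev barZero : LinPresheaf k S :=
  ∐ fun F : S => (linYoneda k).obj (F ⊠ (D F).dual)

/-- The map sending the summand of `(F, G)` to that of `G` by
`ε^{F,r}_G ⊠ G^⋄ : F F^⋄ G G^⋄ ⟶ G G^⋄`. -/
noncomputable def barRight : barOne k D ⟶ barZero k D :=
  Sigma.desc fun a =>
    (linYoneda k).map
        ((assoc (a.1 ⊠ (D a.1).dual) a.2 (D a.2).dual).inv ≫
          ((D a.1).adj.εr a.2 ⊠ₘ 𝟙 (D a.2).dual)) ≫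
      Sigma.ι (fun F : S => (linYoneda k).obj (F ⊠ (D F).dual)) a.2

/-- The map sending the summand of `(F, G)` to that of `F` by
`F ⊠ ε^{G,l}_{F^⋄} : F F^⋄ G G^⋄ ⟶ F F^⋄`. -/
noncomputable def barLeft : barOne k D ⟶ barZero k D :=
  Sigma.desc fun a =>
    (linYoneda k).map
        ((assoc a.1 (D a.1).dual (a.2 ⊠ (D a.2).dual)).hom ≫
          (𝟙 a.1 ⊠ₘ (D a.2).adj.εl (D a.1).dual)) ≫
      Sigma.ι (fun F : S => (linYoneda k).obj (F ⊠ (D F).dual)) a.1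

end Bar

/-! If a unit `𝟙` exists, a map from the representable on `X` to `𝟙` yields, by tensoring with
representables, compatible families `l_H : H ⊠ X ⟶ H` and `r_K : X ⊠ K ⟶ K`. This suggests the
candidate: the presheaf `U` (`multiplier`) of all such pairs, in the spirit of the multiplier
algebra of a nonunital ring. Write `l^u`, `r^u` for the two families of `u`. `U` acts on every
presheaf from both sides, by restriction along `r^u` or `l^u`.

Two facts carry the proof. First, for `u ∈ U(X)` and `v ∈ U(Y)`, the restriction of `u` along
`l^v_X` equals that of `v` along `r^u_Y` (`res_mulL_eq_res_mulR`): the product of `u` and `v` can be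
read from either side. Second, duality gives local units. The counit of `(F, F^⋄)` is a multiplier
`e_F` on `E_F = F ⊠ F^⋄`, and the mixed zigzag says that `r^{e_F}_F` has a section `F ⟶ E_F ⊠ F`;
dually, a left dual of `F` gives a multiplier whose `l`-component at `F` has a section.

Inserting a local unit and restricting along its section inverts the actions, so `U` is a unit, with
the triangle axiom coming from interchange. The same insertion writes every `u ∈ U(X)` as a
restriction of `e_X`. Hence maps `U ⟶ R` are families `x_F ∈ R(E_F)` satisfying the relations
between the `e_F` imposed by the first fact. By Yoneda these are the coforks under the bar pair, so
`U` is the coequalizer. Units are unique up to isomorphism, which transfers the formula to all of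
them. -/

namespace SemigroupCategory

/-! ### Uniqueness of units, and multipliers on an object. -/

section Basic

variable {C : Type u} [Category.{v} C] [SemigroupCategory C]

/-- Two tensor units of a semigroup category are isomorphic. -/
def TensorUnit.isoOf (I J : TensorUnit C) : I.obj ≅ J.obj :=
  (J.rightUnitor I.obj).symm ≪≫ I.leftUnitor J.obj

theorem id_tensor_comp (H : C) {X Y Z : C} (f : X ⟶ Y) (g : Y ⟶ Z) :
    (𝟙 H ⊠ₘ (f ≫ g)) = (𝟙 H ⊠ₘ f) ≫ (𝟙 H ⊠ₘ g) := by
  rw [← tensorHom_comp, Category.comp_id]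

theorem comp_tensor_id (H : C) {X Y Z : C} (f : X ⟶ Y) (g : Y ⟶ Z) :
    ((f ≫ g) ⊠ₘ 𝟙 H) = (f ⊠ₘ 𝟙 H) ≫ (g ⊠ₘ 𝟙 H) := by
  rw [← tensorHom_comp, Category.comp_id]

theorem tensor_exchange {X X' Y Y' : C} (f : X ⟶ X') (g : Y ⟶ Y') :
    (f ⊠ₘ 𝟙 Y) ≫ (𝟙 X' ⊠ₘ g) = (𝟙 X ⊠ₘ g) ≫ (f ⊠ₘ 𝟙 Y') := by
  rw [← tensorHom_comp, ← tensorHom_comp, Category.comp_id, Category.id_comp, Category.comp_id,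
    Category.id_comp]

/-- A left module transformation `- ⊠ X ⟶ Id` and a right module transformation `X ⊠ - ⟶ Id`
which are compatible with each other: the data of a morphism from `X` to a would-be unit. -/
structure IsMultiplier {X : C} (l : ∀ H : C, H ⊠ X ⟶ H) (r : ∀ K : C, X ⊠ K ⟶ K) : Prop where
  l_naturality {H H' : C} (f : H ⟶ H') : (f ⊠ₘ 𝟙 X) ≫ l H' = l H ≫ f
  r_naturality {K K' : C} (f : K ⟶ K') : (𝟙 X ⊠ₘ f) ≫ r K' = r K ≫ f
  l_module (H K : C) : (assoc H K X).hom ≫ (𝟙 H ⊠ₘ l K) = l (H ⊠ K)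
  r_module (H K : C) : (assoc X H K).hom ≫ r (H ⊠ K) = r H ⊠ₘ 𝟙 K
  interchange (H K : C) : (assoc H X K).hom ≫ (𝟙 H ⊠ₘ r K) = l H ⊠ₘ 𝟙 K

/-- The source of multipliers in the proof: the local units below are all counits. -/
theorem NonunitalAdjunction.isMultiplier {F G : C} (A : NonunitalAdjunction F G) :
    IsMultiplier A.εl A.εr :=
  ⟨A.εl_naturality, A.εr_naturality, A.εl_module, A.εr_module, A.interchange_ε⟩

/-- Multipliers restrict along morphisms. -/
theorem IsMultiplier.comp {X Y : C} {l : ∀ H : C, H ⊠ Y ⟶ H} {r : ∀ K : C, Y ⊠ K ⟶ K}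
    (h : IsMultiplier l r) (f : X ⟶ Y) :
    IsMultiplier (fun H => (𝟙 H ⊠ₘ f) ≫ l H) (fun K => (f ⊠ₘ 𝟙 K) ≫ r K) where
  l_naturality {H H'} g := by
    rw [← Category.assoc, tensor_exchange, Category.assoc, h.l_naturality, Category.assoc]
  r_naturality {K K'} g := by
    rw [← Category.assoc, ← tensor_exchange, Category.assoc, h.r_naturality, Category.assoc]
  l_module H K := by
    rw [id_tensor_comp, ← Category.assoc, ← associator_naturality, Category.assoc, h.l_module,
      tensorHom_id]
  r_module H K := by
    rw [comp_tensor_id, ← h.r_module, ← Category.assoc, ← Category.assoc, associator_naturality,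
      tensorHom_id]
  interchange H K := by
    rw [id_tensor_comp, ← Category.assoc, ← associator_naturality, Category.assoc, h.interchange,
      comp_tensor_id]

end Basic

section Linear

variable (k : Type w) [Field k] {C : Type u} [Category.{v} C] [Preadditive C] [Linear k C]
  [SemigroupCategory C]

theorem tensor_zero [IsLinear k C] {X X' Y Y' : C} (f : X ⟶ X') : (f ⊠ₘ (0 : Y ⟶ Y')) = 0 := by
  have := IsLinear.tensor_smul (0 : k) f (0 : Y ⟶ Y')
  rwa [zero_smul, zero_smul] at this

theorem zero_tensor [IsLinear k C] {X X' Y Y' : C} (g : Y ⟶ Y') : ((0 : X ⟶ X') ⊠ₘ g) = 0 := by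
  have := IsLinear.smul_tensor (0 : k) (0 : X ⟶ X') g
  rwa [zero_smul, zero_smul] at this

end Linear

end SemigroupCategory

namespace LinPresheaf

/-! ### The presheaf of multipliers and its commutation identity. -/

section Multiplier

variable (k : Type w) [Field k] {S : Type u} [Category.{u} S] [Preadditive S] [Linear k S]
  [SemigroupCategory S] [IsLinear k S]

/-- The vector space of multipliers on `X`. -/
def multiplierSubmodule (X : S) :
    Submodule k ((∀ H : S, H ⊠ X ⟶ H) × (∀ K : S, X ⊠ K ⟶ K)) where
  carrier := { u | IsMultiplier u.1 u.2 }
  zero_mem' := by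
    constructor <;> intros <;> simp [tensor_zero k, zero_tensor k]
  add_mem' := by
    rintro ⟨l, r⟩ ⟨l', r'⟩ h h'
    constructor <;> intros <;>
      simp [IsLinear.tensor_add k, IsLinear.add_tensor k, h.l_naturality, h'.l_naturality,
        h.r_naturality, h'.r_naturality, h.l_module, h'.l_module, h.r_module, h'.r_module,
        h.interchange, h'.interchange]
  smul_mem' := by
    rintro c ⟨l, r⟩ h
    constructor <;> intros <;>
      simp [IsLinear.tensor_smul, IsLinear.smul_tensor, h.l_naturality, h.r_naturality,
        h.l_module, h.r_module, h.interchange]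

/-- The presheaf of multipliers. -/
def multiplier : LinPresheaf k S :=
  ofRes (fun X => multiplierSubmodule k X)
    (fun {X Y} =>
      { toFun := fun f =>
          { toFun := fun u => ⟨(fun H => (𝟙 H ⊠ₘ f) ≫ u.1.1 H, fun K => (f ⊠ₘ 𝟙 K) ≫ u.1.2 K),
              IsMultiplier.comp u.2 f⟩
            map_add' := fun u v => by
              apply Subtype.ext; apply Prod.ext <;> funext <;> simp
            map_smul' := fun c u => by
              apply Subtype.ext; apply Prod.ext <;> funext <;> simp }
        map_add' := fun f g => by
          ext u : 1
          apply Subtype.ext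
          apply Prod.ext <;> funext <;> simp [IsLinear.tensor_add k, IsLinear.add_tensor k]
        map_smul' := fun c f => by
          ext u : 1
          apply Subtype.ext
          apply Prod.ext <;> funext <;> simp [IsLinear.tensor_smul, IsLinear.smul_tensor] })
    (by
      intro X
      ext u : 1
      apply Subtype.ext
      apply Prod.ext <;> funext <;> simp [tensorHom_id])
    (by
      intro X Y Z f g
      ext u : 1
      apply Subtype.ext
      apply Prod.ext <;> funext <;> simp [id_tensor_comp, comp_tensor_id])

variable {k}

/-- The left module transformation of a multiplier. -/
def mulL {X : S} (H : S) : (multiplier k (S := S)).val X →ₗ[k] (H ⊠ X ⟶ H) :=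
  ({ toFun := fun u => u.1.1 H, map_add' := fun _ _ => rfl, map_smul' := fun _ _ => rfl } :
    multiplierSubmodule k X →ₗ[k] (H ⊠ X ⟶ H))

/-- The right module transformation of a multiplier. -/
def mulR {X : S} (K : S) : (multiplier k (S := S)).val X →ₗ[k] (X ⊠ K ⟶ K) :=
  ({ toFun := fun u => u.1.2 K, map_add' := fun _ _ => rfl, map_smul' := fun _ _ => rfl } :
    multiplierSubmodule k X →ₗ[k] (X ⊠ K ⟶ K))

theorem isMultiplier {X : S} (u : (multiplier k (S := S)).val X) :
    IsMultiplier (fun H => mulL H u) (fun K => mulR K u) :=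
  Subtype.property (p := fun u => u ∈ multiplierSubmodule k X) u

theorem multiplier_ext {X : S} {u v : (multiplier k (S := S)).val X}
    (hl : ∀ H, mulL H u = mulL H v) (hr : ∀ K, mulR K u = mulR K v) : u = v :=
  Subtype.ext (p := fun u => u ∈ multiplierSubmodule k X) (Prod.ext (funext hl) (funext hr))

theorem mulL_res {X Y : S} (f : X ⟶ Y) (u : (multiplier k (S := S)).val Y) (H : S) :
    mulL H ((multiplier k).res f u) = (𝟙 H ⊠ₘ f) ≫ mulL H u := rfl

theorem mulR_res {X Y : S} (f : X ⟶ Y) (u : (multiplier k (S := S)).val Y) (K : S) :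
    mulR K ((multiplier k).res f u) = (f ⊠ₘ 𝟙 K) ≫ mulR K u := rfl

variable (k) in
/-- The counit of an adjunction, as a multiplier. -/
def counit {F G : S} (A : NonunitalAdjunction F G) : (multiplier k (S := S)).val (F ⊠ G) :=
  (⟨(A.εl, A.εr), A.isMultiplier⟩ : multiplierSubmodule k (F ⊠ G))

theorem mulL_counit {F G : S} (A : NonunitalAdjunction F G) (H : S) :
    mulL H (counit k A) = A.εl H := rfl

theorem mulR_counit {F G : S} (A : NonunitalAdjunction F G) (K : S) :
    mulR K (counit k A) = A.εr K := rfl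

/-- The two ways of multiplying multipliers agree. -/
theorem res_mulL_eq_res_mulR {X Y : S} (u : (multiplier k (S := S)).val X)
    (v : (multiplier k (S := S)).val Y) :
    (multiplier k).res (mulL X v) u = (multiplier k).res (mulR Y u) v := by
  have hu := isMultiplier u
  have hv := isMultiplier v
  apply multiplier_ext
  -- After precomposing with the associator, the module axiom for `l^v` and interchange for `u` turn
  -- the sides into `l^v_{H ⊠ X} ≫ l^u_H` and `(l^u_H ⊠ Y) ≫ l^v_H`, which is naturality of `l^v`.
  · intro H
    rw [mulL_res, mulL_res, ← cancel_epi (assoc H X Y).hom, ← Category.assoc, ← Category.assoc,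
      hv.l_module, hu.interchange, hv.l_naturality]
  -- The mirror argument: the module axiom for `r^u` and interchange for `v` reduce this to
  -- naturality of `r^u` along `r^v_K`.
  · intro K
    rw [mulR_res, mulR_res, ← hu.r_module, ← hv.interchange, Category.assoc, Category.assoc,
      hu.r_naturality]

end Multiplier

/-! ### Local units invert the actions, so the multipliers form a unit. -/

section Unit

variable {k : Type w} [Field k] {S : Type u} [Category.{u} S] [Preadditive S] [Linear k S]
  [SemigroupCategory S] [IsLinear k S]

/-- The action `U ⊛ P ⟶ P` of the multipliers. -/
noncomputable def leftAction (P : LinPresheaf k S) : day (multiplier k) P ⟶ P :=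
  dayDesc (fun _ K => P.res ∘ₗ mulR K) <| by
    intro X K X' K' f g u p
    change P.res (mulR K ((multiplier k).res f u)) (P.res g p) =
      P.res (f ⊠ₘ g) (P.res (mulR K' u) p)
    rw [mulR_res, ← res_comp, ← res_comp, Category.assoc, ← (isMultiplier u).r_naturality,
      ← Category.assoc, ← tensorHom_comp, Category.id_comp, Category.comp_id]

theorem app_leftAction (P : LinPresheaf k S) {X K : S} (u : (multiplier k (S := S)).val X)
    (p : P.val K) : app (leftAction P) _ (pair _ P X K u p) = P.res (mulR K u) p :=
  app_dayDesc _ _ _ _ _ _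

/-- The action `P ⊛ U ⟶ P` of the multipliers. -/
noncomputable def rightAction (P : LinPresheaf k S) : day P (multiplier k) ⟶ P :=
  dayDesc (fun H _ => (P.res ∘ₗ mulL H).flip) <| by
    intro H X H' X' g f p u
    change P.res (mulL H ((multiplier k).res f u)) (P.res g p) =
      P.res (g ⊠ₘ f) (P.res (mulL H' u) p)
    rw [mulL_res, ← res_comp, ← res_comp, Category.assoc, ← (isMultiplier u).l_naturality,
      ← Category.assoc, ← tensorHom_comp, Category.id_comp, Category.comp_id]

theorem app_rightAction (P : LinPresheaf k S) {X H : S} (p : P.val H)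
    (u : (multiplier k (S := S)).val X) :
    app (rightAction P) _ (pair P _ H X p u) = P.res (mulL H u) p :=
  app_dayDesc _ _ _ _ _ _

variable (k) in
/-- A multiplier on some object `E` whose right action on `K` is split by `K ⟶ E ⊠ K`. -/
structure LocalLeftUnit (K : S) where
  obj : S
  elt : (multiplier k (S := S)).val obj
  split : K ⟶ obj ⊠ K
  split_comp : split ≫ mulR K elt = 𝟙 K

variable (k) in
/-- A multiplier on some object `E` whose left action on `H` is split by `H ⟶ H ⊠ E`. -/
structure LocalRightUnit (H : S) where
  obj : S
  elt : (multiplier k (S := S)).val obj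
  split : H ⟶ H ⊠ obj
  split_comp : split ≫ mulL H elt = 𝟙 H

variable (k) in
/-- An adjunction `(F, G)` gives a local left unit for `F`. -/
def localLeftUnit {F G : S} (A : NonunitalAdjunction F G) : LocalLeftUnit k F where
  obj := F ⊠ G
  elt := counit k A
  split := A.ηl F ≫ (assoc F G F).inv
  split_comp := by
    rw [mulR_counit, Category.assoc, A.zigzag_left]

variable (k) in
/-- An adjunction `(F, G)` gives a local right unit for `G`. -/
def localRightUnit {F G : S} (A : NonunitalAdjunction F G) : LocalRightUnit k G where
  obj := F ⊠ G
  elt := counit k A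
  split := A.ηr G ≫ (assoc G F G).hom
  split_comp := by
    rw [mulL_counit, Category.assoc, A.zigzag_right]

/-- Interchange trades `X ⊠ r^e_K` for `l^e_X ⊠ K`, so a section of `r^e_K` also splits `l^e_X ⊠ K`
for every `X`, although `l^e_X` itself need not split. -/
theorem LocalLeftUnit.split_mul {K : S} (e : LocalLeftUnit k K) (X : S) :
    (𝟙 X ⊠ₘ e.split) ≫ (assoc X e.obj K).inv ≫ (mulL X e.elt ⊠ₘ 𝟙 K) = 𝟙 (X ⊠ K) := by
  rw [← (isMultiplier e.elt).interchange, Iso.inv_hom_id_assoc, ← id_tensor_comp, e.split_comp,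
    tensorHom_id]

theorem LocalRightUnit.split_mul {H : S} (e : LocalRightUnit k H) (X : S) :
    (e.split ⊠ₘ 𝟙 X) ≫ (assoc H e.obj X).hom ≫ (𝟙 H ⊠ₘ mulR X e.elt) = 𝟙 (H ⊠ X) := by
  rw [(isMultiplier e.elt).interchange, ← comp_tensor_id, e.split_comp, tensorHom_id]

/-- Naturality and the module axiom push `r^u` past the section, from `K` onto `E`, where `u` meets
`e` and the commutation identity applies. -/
theorem LocalLeftUnit.mulR_split {K : S} (e : LocalLeftUnit k K) {X : S}
    (u : (multiplier k (S := S)).val X) :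
    mulR K u ≫ e.split =
      (𝟙 X ⊠ₘ e.split) ≫ (assoc X e.obj K).inv ≫ (mulR e.obj u ⊠ₘ 𝟙 K) := by
  rw [← (isMultiplier u).r_module, Iso.inv_hom_id_assoc, (isMultiplier u).r_naturality]

theorem LocalRightUnit.mulL_split {H : S} (e : LocalRightUnit k H) {X : S}
    (u : (multiplier k (S := S)).val X) :
    mulL H u ≫ e.split =
      (e.split ⊠ₘ 𝟙 X) ≫ (assoc H e.obj X).hom ≫ (𝟙 H ⊠ₘ mulL e.obj u) := by
  rw [(isMultiplier u).l_module, (isMultiplier u).l_naturality]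

/-- `P(K) → (U ⊛ P)(K)`, the inverse of the left action. -/
noncomputable def leftCoaction (P : LinPresheaf k S) {K : S} (e : LocalLeftUnit k K) :
    P.val K →ₗ[k] (day (multiplier k) P).val K :=
  (day (multiplier k) P).res e.split ∘ₗ pair _ P e.obj K e.elt

/-- `P(H) → (P ⊛ U)(H)`, the inverse of the right action. -/
noncomputable def rightCoaction (P : LinPresheaf k S) {H : S} (e : LocalRightUnit k H) :
    P.val H →ₗ[k] (day P (multiplier k)).val H :=
  (day P (multiplier k)).res e.split ∘ₗ (pair P _ H e.obj).flip e.elt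

/-- Coaction after action fixes the pairing of `u` and `p`. Once `r^u` is pushed past the section it
acts on `e`; commutation replaces this by `l^e_X` acting on `u`, and `split_mul` cancels `l^e_X ⊠
K`. -/
theorem res_mulR_leftCoaction (P : LinPresheaf k S) {K X : S} (e : LocalLeftUnit k K)
    (u : (multiplier k (S := S)).val X) (p : P.val K) :
    (day (multiplier k) P).res (mulR K u) (leftCoaction P e p) = pair _ P X K u p := by
  have h1 := pair_res (multiplier k) P (mulR e.obj u) (𝟙 K) e.elt p
  have h2 := pair_res (multiplier k) P (mulL X e.elt) (𝟙 K) u p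
  rw [res_id] at h1 h2
  change (day (multiplier k) P).res (mulR K u) ((day (multiplier k) P).res e.split
    (pair _ P e.obj K e.elt p)) = _
  rw [← res_comp, e.mulR_split, res_comp, res_comp, ← h1, ← res_mulL_eq_res_mulR, h2, ← res_comp,
    ← res_comp, Category.assoc, e.split_mul, res_id]

theorem res_mulL_rightCoaction (P : LinPresheaf k S) {H X : S} (e : LocalRightUnit k H)
    (u : (multiplier k (S := S)).val X) (p : P.val H) :
    (day P (multiplier k)).res (mulL H u) (rightCoaction P e p) = pair P _ H X p u := by
  have h1 := pair_res P (multiplier k) (𝟙 H) (mulL e.obj u) p e.elt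
  have h2 := pair_res P (multiplier k) (𝟙 H) (mulR X e.elt) p u
  rw [res_id] at h1 h2
  change (day P (multiplier k)).res (mulL H u) ((day P (multiplier k)).res e.split
    (pair P _ H e.obj p e.elt)) = _
  rw [← res_comp, e.mulL_split, res_comp, res_comp, ← h1, res_mulL_eq_res_mulR, h2, ← res_comp,
    ← res_comp, Category.assoc, e.split_mul, res_id]

/-- Arbitrary local units are allowed at `K` and `L`: this gives naturality and, for `f = 𝟙`,
independence of the choice. The pairing of `e` with `p` is rewritten as a restriction along `r^e_L`
of the coaction through `e'`; then `r^e` slides past `f` and is cancelled by its section. -/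
theorem leftCoaction_res (P : LinPresheaf k S) {K L : S} (e : LocalLeftUnit k K)
    (e' : LocalLeftUnit k L) (f : K ⟶ L) (p : P.val L) :
    leftCoaction P e (P.res f p) = (day (multiplier k) P).res f (leftCoaction P e' p) := by
  have h := pair_res (multiplier k) P (𝟙 e.obj) f e.elt p
  rw [res_id] at h
  change (day (multiplier k) P).res e.split (pair _ P e.obj K e.elt (P.res f p)) = _
  rw [h, ← res_mulR_leftCoaction P e', ← res_comp, ← res_comp, Category.assoc,
    (isMultiplier e.elt).r_naturality, ← Category.assoc, e.split_comp, Category.id_comp]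

theorem rightCoaction_res (P : LinPresheaf k S) {H L : S} (e : LocalRightUnit k H)
    (e' : LocalRightUnit k L) (f : H ⟶ L) (p : P.val L) :
    rightCoaction P e (P.res f p) = (day P (multiplier k)).res f (rightCoaction P e' p) := by
  have h := pair_res P (multiplier k) f (𝟙 e.obj) p e.elt
  rw [res_id] at h
  change (day P (multiplier k)).res e.split (pair P _ H e.obj (P.res f p) e.elt) = _
  rw [h, ← res_mulL_rightCoaction P e', ← res_comp, ← res_comp, Category.assoc,
    (isMultiplier e.elt).l_naturality, ← Category.assoc, e.split_comp, Category.id_comp]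

/-- The left unitor of the multiplier presheaf. -/
noncomputable def multiplierLeftUnitor (e : ∀ K : S, LocalLeftUnit k K) (P : LinPresheaf k S) :
    day (multiplier k) P ≅ P where
  hom := leftAction P
  inv := mkHom (fun K => leftCoaction P (e K)) fun f p => leftCoaction_res P _ _ f p
  hom_inv_id := day_hom_ext fun X K u p => by
    rw [app_comp, app_leftAction, app_mkHom, leftCoaction_res P _ (e K), res_mulR_leftCoaction,
      app_id]
  inv_hom_id := hom_ext' fun K p => by
    rw [app_comp, app_mkHom, app_id]
    change app (leftAction P) K ((day (multiplier k) P).res (e K).split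
      (pair _ P (e K).obj K (e K).elt p)) = p
    rw [app_res, app_leftAction, ← res_comp, (e K).split_comp, res_id]

/-- The right unitor of the multiplier presheaf. -/
noncomputable def multiplierRightUnitor (e : ∀ H : S, LocalRightUnit k H) (P : LinPresheaf k S) :
    day P (multiplier k) ≅ P where
  hom := rightAction P
  inv := mkHom (fun K => rightCoaction P (e K)) fun f p => rightCoaction_res P _ _ f p
  hom_inv_id := day_hom_ext fun H X p u => by
    rw [app_comp, app_rightAction, app_mkHom, rightCoaction_res P _ (e H),
      res_mulL_rightCoaction, app_id]
  inv_hom_id := hom_ext' fun H p => by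
    rw [app_comp, app_mkHom, app_id]
    change app (rightAction P) H ((day P (multiplier k)).res (e H).split
      (pair P _ H (e H).obj p (e H).elt)) = p
    rw [app_res, app_rightAction, ← res_comp, (e H).split_comp, res_id]

/-- The multiplier presheaf is a unit for Day convolution as soon as every object has local
units. -/
noncomputable def multiplierUnit (e : ∀ K : S, LocalLeftUnit k K)
    (e' : ∀ H : S, LocalRightUnit k H) : TensorUnit (LinPresheaf k S) where
  obj := multiplier k
  leftUnitor := multiplierLeftUnitor e
  rightUnitor := multiplierRightUnitor e'
  leftUnitor_naturality {P Q} α := day_hom_ext fun X K u p => by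
    change app (dayMap (𝟙 _) α ≫ leftAction Q) _ _ = app (leftAction P ≫ α) _ _
    rw [app_comp, app_comp, app_dayMap, app_leftAction, app_leftAction, app_res, app_id]
  rightUnitor_naturality {P Q} α := day_hom_ext fun H X p u => by
    change app (dayMap α (𝟙 _) ≫ rightAction Q) _ _ = app (rightAction P ≫ α) _ _
    rw [app_comp, app_comp, app_dayMap, app_rightAction, app_rightAction, app_res, app_id]
  triangle P Q := day_hom_ext_left fun H X K p u q => by
    change app (assocHom P (multiplier k) Q ≫ dayMap (𝟙 P) (leftAction Q)) _ _ =
      app (dayMap (rightAction P) (𝟙 Q)) _ _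
    have h1 := pair_res P Q (mulL H u) (𝟙 K) p q
    have h2 := pair_res P Q (𝟙 H) (mulR K u) p q
    rw [res_id] at h1 h2
    rw [app_comp, app_assocHom, app_res, app_dayMap, app_dayMap, app_leftAction, app_rightAction,
      app_id, app_id, h1, h2, ← res_comp, (isMultiplier u).interchange]

end Unit

/-! ### Maps out of the multipliers, and the bar presentation. -/

section Coequalizer

variable {k : Type w} [Field k] {S : Type u} [Category.{u} S] [Preadditive S] [Linear k S]

/-- The morphism `S(-, E) ⟶ R` attached to an element of `R(E)`. -/
def yonedaHom {R : LinPresheaf k S} {E : S} (x : R.val E) : (linYoneda k).obj E ⟶ R :=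
  mkHom (P := (linYoneda k).obj E) (fun _ => R.res.flip x) fun f g => R.res_comp f g x

/-- The element of `R(E)` attached to a morphism `S(-, E) ⟶ R`. -/
def yonedaElt {R : LinPresheaf k S} {E : S} (α : (linYoneda k).obj E ⟶ R) : R.val E :=
  app α E (𝟙 E : E ⟶ E)

theorem app_eq_res_yonedaElt {R : LinPresheaf k S} {E X : S} (α : (linYoneda k).obj E ⟶ R)
    (g : X ⟶ E) : app α X g = R.res g (yonedaElt α) := by
  refine Eq.trans ?_ (app_res α g (𝟙 E : E ⟶ E))
  exact congrArg (app α X) (Category.comp_id g).symm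

theorem yonedaHom_ext {R : LinPresheaf k S} {E : S} {α β : (linYoneda k).obj E ⟶ R}
    (h : yonedaElt α = yonedaElt β) : α = β :=
  hom_ext' fun X g => by
    refine (app_eq_res_yonedaElt α g).trans (Eq.trans ?_ (app_eq_res_yonedaElt β g).symm)
    rw [h]

theorem yonedaElt_yonedaHom {R : LinPresheaf k S} {E : S} (x : R.val E) :
    yonedaElt (yonedaHom x) = x := R.res_id x

theorem yonedaElt_comp {R T : LinPresheaf k S} {E : S} (α : (linYoneda k).obj E ⟶ R)
    (β : R ⟶ T) : yonedaElt (α ≫ β) = app β E (yonedaElt α) := rfl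

theorem yonedaElt_map_comp {R : LinPresheaf k S} {E E' : S} (f : E ⟶ E')
    (α : (linYoneda k).obj E' ⟶ R) :
    yonedaElt ((linYoneda k).map f ≫ α) = R.res f (yonedaElt α) := by
  refine Eq.trans ?_ (app_eq_res_yonedaElt α f)
  exact congrArg (app α E) (Category.id_comp f)

variable [SemigroupCategory S] [IsLinear k S]

/-- For a family `x` of elements of `R`, indexed by a family of local units, the map
`U(X) → R(X)` sending `e_X` to `x_X`. -/
def multiplierLift {R : LinPresheaf k S} {X : S} (e : LocalLeftUnit k X) (x : R.val e.obj) :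
    (multiplier k).val X →ₗ[k] R.val X :=
  R.res.flip x ∘ₗ Linear.leftComp k e.obj e.split ∘ₗ mulL e.obj

theorem multiplierLift_apply {R : LinPresheaf k S} {X : S} (e : LocalLeftUnit k X)
    (x : R.val e.obj) (u : (multiplier k (S := S)).val X) :
    multiplierLift e x u = R.res (e.split ≫ mulL e.obj u) x := rfl

/-- In `U`, restricting `u` along `r^{e'}_X` gives the restriction of `e'` along `l^u_{E'}`; this is
the image of that identity with `x'` in place of `e'`. The right side no longer involves `e` or `x`,
so lifts built from different local units can be compared. -/
theorem res_mulR_multiplierLift {R : LinPresheaf k S} {X Y : S} (e : LocalLeftUnit k X)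
    (e' : LocalLeftUnit k Y) (x : R.val e.obj) (x' : R.val e'.obj)
    (h : R.res (mulR e.obj e'.elt) x = R.res (mulL e'.obj e.elt) x')
    (u : (multiplier k (S := S)).val X) :
    R.res (mulR X e'.elt) (multiplierLift e x u) = R.res (mulL e'.obj u) x' := by
  rw [multiplierLift_apply, ← res_comp, ← Category.assoc, e.mulR_split, Category.assoc,
    Category.assoc, (isMultiplier u).l_naturality, ← Category.assoc, ← Category.assoc, res_comp, h,
    ← res_comp, Category.assoc, ← (isMultiplier u).l_naturality, Category.assoc,
    ← Category.assoc (assoc _ _ _).inv, ← Category.assoc, e.split_mul, Category.id_comp]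

/-- A split epimorphism restricts injectively; this allows equalities in `R(X)` to be tested after
acting by a local unit. -/
theorem LocalLeftUnit.res_injective {X : S} (e : LocalLeftUnit k X) {R : LinPresheaf k S}
    {x y : R.val X} (h : R.res (mulR X e.elt) x = R.res (mulR X e.elt) y) : x = y := by
  have := congrArg (R.res e.split) h
  rwa [← res_comp, ← res_comp, e.split_comp, res_id, res_id] at this

/-- The morphism from the multipliers attached to a compatible family. -/
def multiplierDesc {R : LinPresheaf k S} (e : ∀ X : S, LocalLeftUnit k X)
    (x : ∀ X, R.val (e X).obj)
    (h : ∀ X Y, R.res (mulR (e X).obj (e Y).elt) (x X) = R.res (mulL (e Y).obj (e X).elt) (x Y)) :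
    multiplier k ⟶ R :=
  mkHom (fun X => multiplierLift (e X) (x X)) fun {X Y} f u => by
    -- After restriction along `r^{e_X}_X`, both sides become restrictions of the single element `x
    -- X`.
    apply (e X).res_injective
    rw [res_mulR_multiplierLift (e X) (e X) (x X) (x X) (h X X), ← res_comp,
      ← (isMultiplier (e X).elt).r_naturality, res_comp,
      res_mulR_multiplierLift (e Y) (e X) (x Y) (x X) (h Y X), ← res_comp, mulL_res]

theorem app_multiplierDesc {R : LinPresheaf k S} (e : ∀ X : S, LocalLeftUnit k X)
    (x : ∀ X, R.val (e X).obj) (h) (X : S) :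
    app (multiplierDesc e x h) _ (e X).elt = x X := by
  -- The component at `E_X` is built from `x` at the object `E_X`, not from `x X`; the compatibility
  -- relation for the pair `(X, E_X)` links the two.
  apply (e (e X).obj).res_injective
  change R.res _ (multiplierLift (e (e X).obj) (x _) (e X).elt) = _
  rw [res_mulR_multiplierLift _ _ _ _ (h _ _), h]

/-- The local units generate: by commutation, restricting `e_X` along `l^u_{E_X}` is restricting `u`
along `r^{e_X}_X`, and the section recovers `u`. -/
theorem multiplier_hom_ext {R : LinPresheaf k S} (e : ∀ X : S, LocalLeftUnit k X)
    {α β : multiplier k ⟶ R} (h : ∀ X, app α _ (e X).elt = app β _ (e X).elt) : α = β :=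
  hom_ext' fun X u => by
    have key : (multiplier k).res ((e X).split ≫ mulL (e X).obj u) (e X).elt = u := by
      rw [res_comp, res_mulL_eq_res_mulR, ← res_comp, (e X).split_comp, res_id]
    rw [← key, app_res, app_res, h]

/-- The multiplier presheaf is the coequalizer of the bar construction. -/
theorem nonempty_multiplier_iso_coequalizer (D : ∀ F : S, RightDual F) :
    Nonempty (multiplier k ≅ coequalizer (barRight k D) (barLeft k D)) := by
  let e : ∀ X : S, LocalLeftUnit k X := fun X => localLeftUnit k (D X).adj
  -- The module axioms identify the two bar maps, on the summand `(Y, X)`, with the components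
  -- `r^{e_Y}` at `E_X` and `l^{e_X}` at `E_Y`. The cofork condition thus becomes the compatibility
  -- hypothesis of `multiplierDesc`.
  have hR : ∀ X Y : S, mulR (e X).obj (e Y).elt =
      (assoc (Y ⊠ (D Y).dual) X (D X).dual).inv ≫ ((D Y).adj.εr X ⊠ₘ 𝟙 (D X).dual) := by
    intro X Y
    rw [← (D Y).adj.εr_module, Iso.inv_hom_id_assoc]
    rfl
  have hL : ∀ X Y : S, mulL (e Y).obj (e X).elt =
      (assoc Y (D Y).dual (X ⊠ (D X).dual)).hom ≫ (𝟙 Y ⊠ₘ (D X).adj.εl (D Y).dual) := by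
    intro X Y
    rw [(D X).adj.εl_module]
    rfl
  let π : barZero k D ⟶ multiplier k := Sigma.desc fun F => yonedaHom (e F).elt
  have hπ : barRight k D ≫ π = barLeft k D ≫ π := by
    apply Sigma.hom_ext
    rintro ⟨Y, X⟩
    simp only [barRight, barLeft, π, Sigma.ι_desc_assoc, Category.assoc, Sigma.ι_desc]
    apply yonedaHom_ext
    rw [yonedaElt_map_comp, yonedaElt_map_comp, ← hR, ← hL]
    refine (congrArg _ (yonedaElt_yonedaHom (e X).elt)).trans (Eq.trans ?_
      (congrArg _ (yonedaElt_yonedaHom (e Y).elt)).symm)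
    exact (res_mulL_eq_res_mulR (e Y).elt (e X).elt).symm
  have hc : IsColimit (Cofork.ofπ π hπ) := by
    refine Cofork.IsColimit.mk _ (fun s => multiplierDesc e
      (fun F => yonedaElt (Sigma.ι (fun F : S => (linYoneda k).obj (F ⊠ (D F).dual)) F ≫ s.π))
      ?_) ?_ ?_
    · intro X Y
      have h := congrArg (fun t => yonedaElt (Sigma.ι (fun a : S × S => (linYoneda k).obj
        ((a.1 ⊠ (D a.1).dual) ⊠ (a.2 ⊠ (D a.2).dual))) (Y, X) ≫ t)) s.condition
      simp only [barRight, barLeft, Sigma.ι_desc_assoc, Category.assoc] at h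
      rw [yonedaElt_map_comp, yonedaElt_map_comp, ← hR, ← hL] at h
      exact h
    · intro s
      apply Sigma.hom_ext
      intro F
      simp only [Cofork.π_ofπ, π, Sigma.ι_desc_assoc]
      apply yonedaHom_ext
      rw [yonedaElt_comp]
      exact (congrArg _ (yonedaElt_yonedaHom (e F).elt)).trans (app_multiplierDesc e _ _ F)
    · intro s m hm
      apply multiplier_hom_ext e
      intro F
      have h : Sigma.ι (fun F : S => (linYoneda k).obj (F ⊠ (D F).dual)) F ≫ s.π =
          yonedaHom (e F).elt ≫ m := by
        rw [← hm]
        simp only [Cofork.π_ofπ, π, Sigma.ι_desc_assoc]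
        rfl
      refine Eq.trans ?_ ((app_multiplierDesc e _ _ F).trans (congrArg yonedaElt h)).symm
      exact (congrArg (app m _) (yonedaElt_yonedaHom (e F).elt)).symm
  exact ⟨hc.coconePointUniqueUpToIso (colimit.isColimit _)⟩

end Coequalizer

end LinPresheaf

theorem theorem3p16 {k : Type w} [Field k] {S : Type u} [Category.{u} S] [Preadditive S]
    [Linear k S] [SemigroupCategory S] [SemigroupCategory.IsLinear k S]
    (hS : SemigroupCategory.IsRigid S) (D : ∀ F : S, SemigroupCategory.RightDual F) :
    Nonempty (SemigroupCategory.TensorUnit (LinPresheaf k S)) ∧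
      ∀ I : SemigroupCategory.TensorUnit (LinPresheaf k S),
        Nonempty (I.obj ≅ coequalizer (barRight k D) (barLeft k D)) := by
  -- Right local units at `F` need `F` as the right-hand member of an adjunction, hence a left dual;
  -- the chosen right duals `D` supply the left local units and the bar presentation.
  choose G hG using fun F => (hS F).2
  let U : TensorUnit (LinPresheaf k S) := LinPresheaf.multiplierUnit
    (fun F => LinPresheaf.localLeftUnit k (D F).adj)
    (fun F => LinPresheaf.localRightUnit k (hG F).some)
  obtain ⟨i⟩ := LinPresheaf.nonempty_multiplier_iso_coequalizer (k := k) D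
  exact ⟨⟨U⟩, fun I => ⟨I.isoOf U ≪≫ i⟩⟩
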